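/- Let $n\ge 2$, $A=[a_{i,j}]\in\mathbb{C}^{n\times n}$ and $\mathcal N=\{1,\dots,n\}$. Write $r_i(A)=\sum_{j\ne i}|a_{i,j}|$ and $c_i(A)=\sum_{j\ne i}|a_{j,i}|$, and let $D^P_n$ be the set of diagonal matrices of order $n$ with positive diagonal entries. $A\in GDD$ (generalized diagonally dominant) means that there is $X\in D^P_n$ with $|a_{i,i}|>r_i(X^{-1}AX)$ for all $i\in\mathcal N$. A matrix is reducible if a simultaneous permutation of its rows and columns brings it to the form $\begin{bmatrix}A_{1,1}&A_{1,2}\\0&A_{2,2}\end{bmatrix}$ with square diagonal blocks of positive order; otherwise it is irreducible. A Frobenius normal form of $A$ is a simultaneous permutation of rows and columns that makes $A$ block upper triangular with irreducible (nonempty) diagonal blocks $A_{k,k}$ (blocks of order one, zero or not, are allowed; $A$ itself is its only block if it is irreducible). The reduced sums $\tilde r_i(A)$ and $\tilde c_i(A)$ are the deleted absolute row sum and column sum, inside the diagonal block $A_{k,k}$ that contains the diagonal entry $a_{i,i}$, of the row and of the column that come from the row and the column $i$ of $A$; they do not depend on the normal form. For $X,Y\in D^P_n$ put $\tilde r^X(A)=\tilde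 r(X^{-1}AX)$ and $\tilde c^Y(A)=\tilde c(Y^{-1}AY)$, abbreviated below to $\tilde r_i=\tilde r_i^X(A)$ and $\tilde c_i=\tilde c_i^Y(A)$; $X$ and $Y$ may differ. Powers follow the convention $0^0=1$ and $0^t=0$ for $t>0$. **Theorem.** $A\in GDD$ if and only if there exist $X,Y\in D^P_n$ and $\alpha,\beta\in[0,1]$ such that one and the same of the following conditions (1)–(22) holds for all $i,j\in\mathcal N$ with $i\ne j$. Moreover each single condition is a characterization: for every $k\in\{1,\dots,22\}$, $A\in GDD$ if and only if there exist $X,Y\in D^P_n$ and $\alpha,\beta\in[0,1]$ (depending on $k$) such that condition ($k$) holds for all $i\ne j$. 1. $|a_{i,i}|>\tilde r_i$; 2. $|a_{i,i}|>\tilde c_i$; 3. $|a_{i,i}|>\tilde r_i^{\alpha}\tilde c_i^{1-\alpha}$; 4. $|a_{i,i}|>\alpha\tilde r_i+(1-\alpha)\tilde c_i$; 5. $|a_{i,i}||a_{j,j}|>\tilde r_i\tilde r_j$; 6. $|a_{i,i}||a_{j,j}|>\tilde c_i\tilde c_j$; 7. $|a_{i,i}||a_{j,j}|>\tilde r_i\tilde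 c_j$; 8. $|a_{i,i}||a_{j,j}|>(\tilde r_i\tilde r_j)^{\alpha}(\tilde c_i\tilde c_j)^{1-\alpha}$; 9. $|a_{i,i}||a_{j,j}|>(\tilde r_i\tilde c_j)^{\alpha}(\tilde r_j\tilde c_i)^{1-\alpha}$; 10. $|a_{i,i}||a_{j,j}|>\alpha\tilde r_i\tilde r_j+(1-\alpha)\tilde c_i\tilde c_j$; 11. $|a_{i,i}||a_{j,j}|>\alpha\tilde r_i\tilde c_j+(1-\alpha)\tilde r_j\tilde c_i$; 12. $|a_{i,i}||a_{j,j}|>[\alpha\tilde r_i+(1-\alpha)\tilde c_i][\alpha\tilde r_j+(1-\alpha)\tilde c_j]$; 13. $|a_{i,i}||a_{j,j}|>[\alpha\tilde r_i+(1-\alpha)\tilde c_i][\alpha\tilde c_j+(1-\alpha)\tilde r_j]$; 14. $|a_{i,i}|^{\alpha}|a_{j,j}|^{1-\alpha}>\tilde r_i^{\alpha}\tilde r_j^{1-\alpha}$; 15. $|a_{i,i}|^{\alpha}|a_{j,j}|^{1-\alpha}>\tilde c_i^{\alpha}\tilde c_j^{1-\alpha}$; 16. $|a_{i,i}|^{\alpha}|a_{j,j}|^{1-\alpha}>\tilde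 r_i^{\alpha}\tilde c_j^{1-\alpha}$; 17. $|a_{i,i}|^{\alpha}|a_{j,j}|^{1-\alpha}>(\tilde r_i^{\beta}\tilde c_i^{1-\beta})^{\alpha}(\tilde r_j^{\beta}\tilde c_j^{1-\beta})^{1-\alpha}$; 18. $|a_{i,i}|^{\alpha}|a_{j,j}|^{1-\alpha}>(\tilde r_i^{\beta}\tilde c_i^{1-\beta})^{\alpha}(\tilde c_j^{\beta}\tilde r_j^{1-\beta})^{1-\alpha}$; 19. $|a_{i,i}|^{\alpha}|a_{j,j}|^{1-\alpha}>\beta\tilde r_i^{\alpha}\tilde r_j^{1-\alpha}+(1-\beta)\tilde c_i^{\alpha}\tilde c_j^{1-\alpha}$; 20. $|a_{i,i}|^{\alpha}|a_{j,j}|^{1-\alpha}>\beta\tilde r_i^{\alpha}\tilde c_j^{1-\alpha}+(1-\beta)\tilde c_i^{\alpha}\tilde r_j^{1-\alpha}$; 21. $|a_{i,i}|^{\alpha}|a_{j,j}|^{1-\alpha}>[\beta\tilde r_i+(1-\beta)\tilde c_i]^{\alpha}[\beta\tilde r_j+(1-\beta)\tilde c_j]^{1-\alpha}$; 22. $|a_{i,i}|^{\alpha}|a_{j,j}|^{1-\alpha}>[\beta\tilde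 r_i+(1-\beta)\tilde c_i]^{\alpha}[\beta\tilde c_j+(1-\beta)\tilde r_j]^{1-\alpha}$. -/

import Mathlib

open scoped Matrix

noncomputable section

namespace GDDCriteria

/-- The `i`-th deleted absolute row sum `r_i(A)`. -/
def rowSum {ι : Type*} [Fintype ι] [DecidableEq ι] (A : Matrix ι ι ℂ) (i : ι) : ℝ :=
  ∑ j ∈ Finset.univ.erase i, ‖A i j‖

/-- The `i`-th deleted absolute column sum `c_i(A)`. -/
def colSum {ι : Type*} [Fintype ι] [DecidableEq ι] (A : Matrix ι ι ℂ) (i : ι) : ℝ :=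
  ∑ j ∈ Finset.univ.erase i, ‖A j i‖

/-- Diagonal matrices of order `n` with positive diagonal entries. -/
def PosDiag (n : ℕ) : Set (Matrix (Fin n) (Fin n) ℂ) :=
  {X | ∃ x : Fin n → ℝ, (∀ i, 0 < x i) ∧ X = Matrix.diagonal (fun i => (x i : ℂ))}

/-- Strict diagonal dominance (by rows). -/
def SDD {n : ℕ} (A : Matrix (Fin n) (Fin n) ℂ) : Prop :=
  ∀ i, rowSum A i < ‖A i i‖

/-- Generalized (strict) diagonal dominance (by rows). -/
def GDD {n : ℕ} (A : Matrix (Fin n) (Fin n) ℂ) : Prop :=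
  ∃ X ∈ PosDiag n, SDD (X⁻¹ * A * X)

/-- `A` is reducible: a simultaneous permutation of rows and columns brings it to the form
`[A₁₁ A₁₂; 0 A₂₂]` with square diagonal blocks of positive orders `κ` and `m`. -/
def Reducible {ι : Type*} (A : Matrix ι ι ℂ) : Prop :=
  ∃ κ m : ℕ, 0 < κ ∧ 0 < m ∧ ∃ e : Fin κ ⊕ Fin m ≃ ι, (A.submatrix e e).toBlocks₂₁ = 0

/-- A Frobenius normal form of `A`: a reordering `e` of the indices into `l` consecutive nonempty
groups that makes `A` block upper triangular with irreducible diagonal blocks (a matrix of order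
one, zero or not, is irreducible). -/
structure FrobeniusForm {n : ℕ} (A : Matrix (Fin n) (Fin n) ℂ) where
  l : ℕ
  size : Fin l → ℕ
  size_pos : ∀ k, 0 < size k
  e : (Σ k : Fin l, Fin (size k)) ≃ Fin n
  triangular : (A.submatrix e e).BlockTriangular Sigma.fst
  irreducible : ∀ k, ¬ Reducible ((A.submatrix e e).blockDiag' k)

namespace FrobeniusForm

variable {n : ℕ} {A : Matrix (Fin n) (Fin n) ℂ}

/-- The `k`-th diagonal block `A_{k,k}`. -/
def block (F : FrobeniusForm A) (k : Fin F.l) : Matrix (Fin (F.size k)) (Fin (F.size k)) ℂ :=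
  (A.submatrix F.e F.e).blockDiag' k

/-- The row sum, inside its diagonal block, of the row of `A` with (original) index `i`. -/
def rowSum (F : FrobeniusForm A) (i : Fin n) : ℝ :=
  GDDCriteria.rowSum (F.block (F.e.symm i).1) (F.e.symm i).2

/-- The column sum, inside its diagonal block, of the column of `A` with (original) index `i`. -/
def colSum (F : FrobeniusForm A) (i : Fin n) : ℝ :=
  GDDCriteria.colSum (F.block (F.e.symm i).1) (F.e.symm i).2

end FrobeniusForm

/-- There is a path from `i` to `j` in the directed graph of `A`. -/
def Reach {n : ℕ} (A : Matrix (Fin n) (Fin n) ℂ) : Fin n → Fin n → Prop :=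
  Relation.ReflTransGen (fun i j => A i j ≠ 0)

/-- A finite preorder maps onto a finite chain, monotonically and with its equivalence classes as
fibres. -/
theorem exists_level {α : Type*} [Preorder α] [Fintype α] :
    ∃ (l : ℕ) (b : α → Fin l), Function.Surjective b ∧ (∀ i j, i ≤ j → b i ≤ b j) ∧
      ∀ i j, b i = b j → i ≤ j := by
  classical
  let f : α → LinearExtension (Antisymmetrization α (· ≤ ·)) :=
    fun i => toLinearExtension (toAntisymmetrization (· ≤ ·) i)
  have hf : Function.Surjective f := Quotient.mk_surjective
  let T : Fintype (LinearExtension (Antisymmetrization α (· ≤ ·))) := Fintype.ofSurjective f hf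
  let o := Fintype.orderIsoFinOfCardEq (LinearExtension (Antisymmetrization α (· ≤ ·))) rfl
  refine ⟨_, fun i => o.symm (f i), o.symm.surjective.comp hf, fun i j h => ?_, fun i j h => ?_⟩
  · exact o.symm.monotone (toLinearExtension.monotone
      (toAntisymmetrization_le_toAntisymmetrization_iff.2 h))
  · have h1 : toAntisymmetrization (· ≤ ·) i = toAntisymmetrization (· ≤ ·) j :=
      o.symm.injective h
    exact toAntisymmetrization_le_toAntisymmetrization_iff.1 h1.le

/-- Every square matrix has a Frobenius normal form. -/
theorem FrobeniusForm.exists {n : ℕ} (A : Matrix (Fin n) (Fin n) ℂ) :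
    Nonempty (FrobeniusForm A) := by
  classical
  let P : Preorder (Fin n) :=
    { le := Reach A
      lt := fun i j => Reach A i j ∧ ¬ Reach A j i
      le_refl := fun i => Relation.ReflTransGen.refl
      le_trans := fun _ _ _ h h' => Relation.ReflTransGen.trans h h' }
  obtain ⟨l, b, hbs, hb, hb'⟩ := @exists_level (Fin n) P _
  change ∀ i j, Reach A i j → b i ≤ b j at hb
  change ∀ i j, b i = b j → Reach A i j at hb'
  let e : (Σ k, Fin (Fintype.card {i // b i = k})) ≃ Fin n :=
    (Equiv.sigmaCongrRight fun k => (Fintype.equivFin {i // b i = k}).symm).trans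
      (Equiv.sigmaFiberEquiv b)
  have he : ∀ p, b (e p) = p.1 := fun p =>
    ((Fintype.equivFin {i // b i = p.1}).symm p.2).2
  refine ⟨⟨_, fun k => Fintype.card {i // b i = k}, ?_, e, ?_, ?_⟩⟩
  · intro k
    obtain ⟨i, hi⟩ := hbs k
    exact Fintype.card_pos_iff.2 ⟨⟨i, hi⟩⟩
  · intro p p' h
    by_contra hne
    have := hb (e p) (e p') (Relation.ReflTransGen.single hne)
    rw [he, he] at this
    exact absurd h (not_lt.2 this)
  · rintro k ⟨κ, m, hκ, hm, f, hf⟩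
    let u : Fin n := e ⟨k, f (Sum.inr ⟨0, hm⟩)⟩
    let v : Fin n := e ⟨k, f (Sum.inl ⟨0, hκ⟩)⟩
    have hu : b u = k := he _
    have hv : b v = k := he _
    have key : ∀ w, Reach A u w → Reach A w v → ∃ y : Fin m, w = e ⟨k, f (Sum.inr y)⟩ := by
      intro w h
      induction h with
      | refl => exact fun _ => ⟨_, rfl⟩
      | @tail w z h1 h2 ih =>
        intro hz
        obtain ⟨y, rfl⟩ := ih (Relation.ReflTransGen.head h2 hz)
        have hzk : b z = k := le_antisymm (hv ▸ hb _ _ hz)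
          (hu ▸ hb _ _ (Relation.ReflTransGen.tail h1 h2))
        obtain ⟨⟨k', t⟩, rfl⟩ := e.surjective z
        have : k' = k := by rw [← hzk]; exact (he ⟨k', t⟩).symm
        subst this
        obtain ⟨s, rfl⟩ := f.surjective t
        rcases s with s | s
        · exact absurd (congrFun (congrFun hf y) s) h2
        · exact ⟨s, rfl⟩
    obtain ⟨y, hy⟩ := key v (hb' _ _ (hu.trans hv.symm)) Relation.ReflTransGen.refl
    have := e.injective hy
    simp at this

/-- Two indices lie in the same diagonal block of a Frobenius normal form exactly when they are
joined by paths in both directions; so the blocks do not depend on the form. -/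
theorem FrobeniusForm.same_block_iff {n : ℕ} {A : Matrix (Fin n) (Fin n) ℂ}
    (F : FrobeniusForm A) (i j : Fin n) :
    (F.e.symm i).1 = (F.e.symm j).1 ↔ Reach A i j ∧ Reach A j i := by
  classical
  have mono : ∀ i j, Reach A i j → (F.e.symm i).1 ≤ (F.e.symm j).1 := by
    intro i j h
    induction h with
    | refl => exact le_rfl
    | @tail w z _ h2 ih =>
      refine ih.trans (not_lt.1 fun hlt => h2 ?_)
      have := F.triangular hlt
      simpa using this
  have conn : ∀ k s t, Reach A (F.e ⟨k, s⟩) (F.e ⟨k, t⟩) := by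
    intro k s t
    by_contra hst
    apply F.irreducible k
    let p : Fin (F.size k) → Prop := fun x => ¬ Reach A (F.e ⟨k, s⟩) (F.e ⟨k, x⟩)
    refine ⟨Fintype.card {x // p x}, Fintype.card {x // ¬ p x},
      Fintype.card_pos_iff.2 ⟨⟨t, hst⟩⟩,
      Fintype.card_pos_iff.2 ⟨⟨s, not_not.2 Relation.ReflTransGen.refl⟩⟩,
      (Equiv.sumCongr (Fintype.equivFin _).symm (Fintype.equivFin _).symm).trans
        (Equiv.sumCompl p), ?_⟩
    ext y x
    by_contra hne
    have hy := not_not.1 ((Fintype.equivFin {x // ¬ p x}).symm y).2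
    have hx := ((Fintype.equivFin {x // p x}).symm x).2
    exact hx (Relation.ReflTransGen.tail hy hne)
  constructor
  · intro h
    obtain ⟨⟨k, s⟩, rfl⟩ := F.e.surjective i
    obtain ⟨⟨k', t⟩, rfl⟩ := F.e.surjective j
    simp only [Equiv.symm_apply_apply] at h
    subst h
    exact ⟨conn _ _ _, conn _ _ _⟩
  · exact fun h => le_antisymm (mono _ _ h.1) (mono _ _ h.2)

open Classical in
theorem FrobeniusForm.rowSum_eq {n : ℕ} {A : Matrix (Fin n) (Fin n) ℂ}
    (F : FrobeniusForm A) (i : Fin n) :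
    F.rowSum i =
      ∑ j ∈ Finset.univ.filter (fun j => j ≠ i ∧ Reach A i j ∧ Reach A j i), ‖A i j‖ := by
  obtain ⟨⟨k, s⟩, rfl⟩ := F.e.surjective i
  simp only [FrobeniusForm.rowSum, GDDCriteria.rowSum, ← F.same_block_iff]
  rw [Equiv.symm_apply_apply]
  refine Finset.sum_bij (fun x _ => F.e ⟨k, x⟩) ?_ ?_ ?_ ?_
  · intro x hx; simpa using hx
  · intro x _ y _ h; simpa using h
  · intro j hj
    obtain ⟨⟨k', t⟩, rfl⟩ := F.e.surjective j
    simp only [Finset.mem_filter, Equiv.symm_apply_apply] at hj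
    obtain ⟨-, h1, h2⟩ := hj
    subst h2
    exact ⟨t, by simpa using h1, rfl⟩
  · intro x _; rfl

open Classical in
theorem FrobeniusForm.colSum_eq {n : ℕ} {A : Matrix (Fin n) (Fin n) ℂ}
    (F : FrobeniusForm A) (i : Fin n) :
    F.colSum i =
      ∑ j ∈ Finset.univ.filter (fun j => j ≠ i ∧ Reach A i j ∧ Reach A j i), ‖A j i‖ := by
  obtain ⟨⟨k, s⟩, rfl⟩ := F.e.surjective i
  simp only [FrobeniusForm.colSum, GDDCriteria.colSum, ← F.same_block_iff]
  rw [Equiv.symm_apply_apply]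
  refine Finset.sum_bij (fun x _ => F.e ⟨k, x⟩) ?_ ?_ ?_ ?_
  · intro x hx; simpa using hx
  · intro x _ y _ h; simpa using h
  · intro j hj
    obtain ⟨⟨k', t⟩, rfl⟩ := F.e.surjective j
    simp only [Finset.mem_filter, Equiv.symm_apply_apply] at hj
    obtain ⟨-, h1, h2⟩ := hj
    subst h2
    exact ⟨t, by simpa using h1, rfl⟩
  · intro x _; rfl

/-- The reduced row sums `r̃_i(A)`: row sums inside the diagonal blocks of a Frobenius normal form
(the choice of the form is immaterial by `FrobeniusForm.rowSum_eq`). -/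
def redRowSum {n : ℕ} (A : Matrix (Fin n) (Fin n) ℂ) (i : Fin n) : ℝ :=
  (Classical.choice (FrobeniusForm.exists A)).rowSum i

/-- The reduced column sums `c̃_i(A)`: column sums inside the diagonal blocks of a Frobenius normal
form (the choice of the form is immaterial by `FrobeniusForm.colSum_eq`). -/
def redColSum {n : ℕ} (A : Matrix (Fin n) (Fin n) ℂ) (i : Fin n) : ℝ :=
  (Classical.choice (FrobeniusForm.exists A)).colSum i

/-- The weighted reduced row sums `r̃_i^X(A)`. -/
def wRedRowSum {n : ℕ} (X A : Matrix (Fin n) (Fin n) ℂ) (i : Fin n) : ℝ :=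
  redRowSum (X⁻¹ * A * X) i

/-- The weighted reduced column sums `c̃_i^Y(A)`. -/
def wRedColSum {n : ℕ} (Y A : Matrix (Fin n) (Fin n) ℂ) (i : Fin n) : ℝ :=
  redColSum (Y⁻¹ * A * Y) i

/-- The twenty-two inequalities for the index pair `i, j`, in terms of the moduli `d` of the
diagonal entries, row quantities `r`, column quantities `c` and parameters `α, β`.
Powers are real powers, with `0 ^ 0 = 1` and `0 ^ t = 0` for `t > 0`. -/
def Criterion {n : ℕ} (d r c : Fin n → ℝ) (α β : ℝ) (i j : Fin n) : Fin 22 → Prop :=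
  ![ -- 1, 2, 3, 4
    d i > r i,
    d i > c i,
    d i > r i ^ α * c i ^ (1 - α),
    d i > α * r i + (1 - α) * c i,
    -- 5, 6, 7
    d i * d j > r i * r j,
    d i * d j > c i * c j,
    d i * d j > r i * c j,
    -- 8, 9
    d i * d j > (r i * r j) ^ α * (c i * c j) ^ (1 - α),
    d i * d j > (r i * c j) ^ α * (r j * c i) ^ (1 - α),
    -- 10, 11
    d i * d j > α * (r i * r j) + (1 - α) * (c i * c j),
    d i * d j > α * (r i * c j) + (1 - α) * (r j * c i),
    -- 12, 13
    d i * d j > (α * r i + (1 - α) * c i) * (α * r j + (1 - α) * c j),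
    d i * d j > (α * r i + (1 - α) * c i) * (α * c j + (1 - α) * r j),
    -- 14, 15, 16
    d i ^ α * d j ^ (1 - α) > r i ^ α * r j ^ (1 - α),
    d i ^ α * d j ^ (1 - α) > c i ^ α * c j ^ (1 - α),
    d i ^ α * d j ^ (1 - α) > r i ^ α * c j ^ (1 - α),
    -- 17, 18
    d i ^ α * d j ^ (1 - α) >
      (r i ^ β * c i ^ (1 - β)) ^ α * (r j ^ β * c j ^ (1 - β)) ^ (1 - α),
    d i ^ α * d j ^ (1 - α) >
      (r i ^ β * c i ^ (1 - β)) ^ α * (c j ^ β * r j ^ (1 - β)) ^ (1 - α),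
    -- 19, 20
    d i ^ α * d j ^ (1 - α) >
      β * (r i ^ α * r j ^ (1 - α)) + (1 - β) * (c i ^ α * c j ^ (1 - α)),
    d i ^ α * d j ^ (1 - α) >
      β * (r i ^ α * c j ^ (1 - α)) + (1 - β) * (c i ^ α * r j ^ (1 - α)),
    -- 21, 22
    d i ^ α * d j ^ (1 - α) >
      (β * r i + (1 - β) * c i) ^ α * (β * r j + (1 - β) * c j) ^ (1 - α),
    d i ^ α * d j ^ (1 - α) >
      (β * r i + (1 - β) * c i) ^ α * (β * c j + (1 - β) * r j) ^ (1 - α)]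

/-- The `k`-th inequality holds for `A`, with weights `X, Y` and parameters `α, β`, for all pairs
of distinct indices. -/
def Satisfies {n : ℕ} (A X Y : Matrix (Fin n) (Fin n) ℂ) (α β : ℝ) (k : Fin 22) : Prop :=
  ∀ i j : Fin n, i ≠ j →
    Criterion (fun t => ‖A t t‖) (wRedRowSum X A) (wRedColSum Y A) α β i j k

end GDDCriteria

end

/-! Write `d` for the moduli of the diagonal entries and `P` for those of the off-diagonal ones. `A`
is GDD exactly when `P x < d x` entrywise for some positive `x` (`gdd_iff_exists_pos`).

Necessity: `diagonal d - P` is then a Z-matrix sending a positive vector to a positive vector, so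
its inverse is nonnegative and its transpose has the same property
(`exists_pos_transpose_mulVec_pos`). This gives `X` and `Y` with `r < d` and `c < d`, and at `α = β
= 1` all the criteria follow.

Sufficiency: weighted AM-GM reduces every criterion to one shape, `r i ^ p * c i ^ q * r j ^ p' * c
j ^ q' < d i ^ (p + q) * d j ^ (p' + q')` (`exists_exponents_of_criterion`). On an irreducible
diagonal block put `Q = P / d` by rows. If no positive vector is dominated there, `Q` has an
eigenvalue `ρ ≥ 1` with positive right and left eigenvectors `u`, `v` (`exists_pos_eigenvectors`).
The Friedland–Karlin inequality (`sum_mul_log_nonneg`), applied to `Q` and to its transpose, says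
that `log (r / d)` and `log (c / d)` have nonnegative mean for the weights `v i * u i`. The weights
`v i * Q i j * u j` on pairs have both marginals equal to `ρ * v i * u i`, so averaging the
logarithm of the pairwise inequality against them yields a negative number that is also nonnegative.
Each block thus has a dominated vector, and rescaling the blocks by powers of a small `ε` glues
these together (`exists_pos_dominated_of_levels`). -/

namespace GDDCriteria

/-! ### Z-matrices and Perron–Frobenius theory -/

section Perron

open Matrix Finset Filter Topology

variable {ι : Type*} [Fintype ι]

/-- Minimum principle: at an index `k` where `z / x` attains its minimum `m`, the sign pattern of
`B` gives `(B z) k ≤ m * (B x) k`, which is negative if `m` is. -/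
theorem nonneg_of_mulVec_nonneg {B : Matrix ι ι ℝ} (hB : ∀ i j, i ≠ j → B i j ≤ 0)
    {x : ι → ℝ} (hx : ∀ i, 0 < x i) (hBx : ∀ i, 0 < (B *ᵥ x) i)
    {z : ι → ℝ} (hz : ∀ i, 0 ≤ (B *ᵥ z) i) (i : ι) : 0 ≤ z i := by
  by_contra! hi
  obtain ⟨k, -, hk⟩ := Finset.exists_min_image univ (fun j => z j / x j) ⟨i, mem_univ i⟩
  set m := z k / x k with hm
  have hm0 : m < 0 := (hk i (mem_univ i)).trans_lt (div_neg_of_neg_of_pos hi (hx i))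
  have h1 : (B *ᵥ z) k ≤ m * (B *ᵥ x) k := by
    simp only [mulVec, dotProduct, mul_sum]
    refine sum_le_sum fun j _ => ?_
    have hj : m * x j ≤ z j := by
      have := hk j (mem_univ j)
      rwa [le_div_iff₀ (hx j)] at this
    by_cases h : k = j
    · subst h
      rw [hm]
      have := (hx k).ne'
      apply le_of_eq
      field_simp
    · nlinarith [hB k j h]
  have h2 := mul_neg_of_neg_of_pos hm0 (hBx k)
  linarith [hz k]

/-- A zero of `u` spreads along the edges of `Q`: if `u a = 0`, then `(Q u) a = 0` is a sum of
nonnegative terms, so `u b = 0` whenever `Q a b ≠ 0`. Irreducibility carries it to `k`. -/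
theorem pos_of_mulVec_eq_smul {Q : Matrix ι ι ℝ} (hQ : ∀ i j, 0 ≤ Q i j)
    (hirr : ∀ i j, Relation.ReflTransGen (fun a b => Q a b ≠ 0) i j)
    {ρ : ℝ} {u : ι → ℝ} (hu : ∀ i, 0 ≤ u i) {k : ι} (hk : u k ≠ 0)
    (h : ∀ i, (Q *ᵥ u) i = ρ * u i) (i : ι) : 0 < u i := by
  refine (hu i).lt_of_ne' fun hi => hk ?_
  clear hk
  induction hirr i k with
  | refl => exact hi
  | @tail a b _ hab ih =>
    have h1 := h a
    rw [ih, mul_zero] at h1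
    have h2 := (sum_eq_zero_iff_of_nonneg fun j _ => mul_nonneg (hQ a j) (hu j)).1 h1 b
      (mem_univ b)
    exact (mul_eq_zero.1 h2).resolve_left hab

variable [DecidableEq ι]

/-- For a kernel vector `v`, the minimum principle applies to both `v` and `-v`. -/
theorem isUnit_det_of_mulVec_pos {B : Matrix ι ι ℝ} (hB : ∀ i j, i ≠ j → B i j ≤ 0)
    {x : ι → ℝ} (hx : ∀ i, 0 < x i) (hBx : ∀ i, 0 < (B *ᵥ x) i) : IsUnit B.det := by
  rw [isUnit_iff_ne_zero]
  intro h
  obtain ⟨v, hv, hv0⟩ := Matrix.exists_mulVec_eq_zero_iff.2 h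
  apply hv
  ext i
  have h1 := nonneg_of_mulVec_nonneg hB hx hBx (z := v) (by simp [hv0]) i
  have h2 := nonneg_of_mulVec_nonneg hB hx hBx (z := -v) (by simp [mulVec_neg, hv0]) i
  simp only [Pi.neg_apply, Pi.zero_apply] at *
  linarith

theorem inv_nonneg_of_mulVec_pos {B : Matrix ι ι ℝ} (hB : ∀ i j, i ≠ j → B i j ≤ 0)
    {x : ι → ℝ} (hx : ∀ i, 0 < x i) (hBx : ∀ i, 0 < (B *ᵥ x) i) (i j : ι) : 0 ≤ B⁻¹ i j := by
  have h := Matrix.mul_nonsing_inv B (isUnit_det_of_mulVec_pos hB hx hBx)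
  refine nonneg_of_mulVec_nonneg hB hx hBx (z := fun i => B⁻¹ i j) (fun k => ?_) i
  have : (B *ᵥ fun i => B⁻¹ i j) k = (1 : Matrix ι ι ℝ) k j := by rw [← h]; rfl
  rw [this, Matrix.one_apply]
  split_ifs <;> norm_num

/-- A `Z`-matrix that maps some positive vector to a positive vector has a transpose with the same
property. -/
theorem exists_pos_transpose_mulVec_pos {B : Matrix ι ι ℝ} (hB : ∀ i j, i ≠ j → B i j ≤ 0)
    {x : ι → ℝ} (hx : ∀ i, 0 < x i) (hBx : ∀ i, 0 < (B *ᵥ x) i) :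
    ∃ y : ι → ℝ, (∀ i, 0 < y i) ∧ ∀ i, 0 < (Bᵀ *ᵥ y) i := by
  have hdet := isUnit_det_of_mulVec_pos hB hx hBx
  have hN := inv_nonneg_of_mulVec_pos hB hx hBx
  have hy : Bᵀ *ᵥ ((B⁻¹)ᵀ *ᵥ 1) = 1 := by
    rw [mulVec_mulVec, ← transpose_mul, nonsing_inv_mul B hdet, transpose_one, one_mulVec]
  set y := (B⁻¹)ᵀ *ᵥ (1 : ι → ℝ) with hydef
  have hy0 : ∀ i, 0 ≤ y i := fun i =>
    sum_nonneg fun j _ => mul_nonneg (hN j i) zero_le_one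
  refine ⟨y, fun i => (hy0 i).lt_of_ne' fun h => ?_, fun i => by rw [hy]; exact one_pos⟩
  -- At a zero of `y` only off-diagonal entries of `B` contribute, and these are nonpositive,
  -- whereas `Bᵀ y = 1`.
  have h1 : (Bᵀ *ᵥ y) i ≤ 0 := by
    refine sum_nonpos fun j _ => ?_
    by_cases hij : j = i
    · simp [hij, h]
    · exact mul_nonpos_of_nonpos_of_nonneg (hB j i hij) (hy0 j)
  rw [hy] at h1
  exact absurd h1 (by simp)

/-- `ρ` is the Collatz–Wielandt infimum and `N` a limit of normalised resolvents `(t - Q)⁻¹` as `t`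
decreases to `ρ`. Working with a matrix instead of a vector gives left and right eigenvectors for
the same `ρ` at once. -/
theorem exists_nonneg_commuting_eigenmatrix {Q : Matrix ι ι ℝ} (hQ : ∀ i j, 0 ≤ Q i j)
    (hnot : ¬ ∃ x : ι → ℝ, (∀ i, 0 < x i) ∧ ∀ i, (Q *ᵥ x) i < x i) :
    ∃ ρ : ℝ, 1 ≤ ρ ∧ ∃ N : Matrix ι ι ℝ, (∀ i j, 0 ≤ N i j) ∧ N ≠ 0 ∧
      Q * N = ρ • N ∧ N * Q = ρ • N := by
  have hne : Nonempty ι := by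
    by_contra h
    rw [not_nonempty_iff] at h
    exact hnot ⟨0, fun i => (IsEmpty.false i).elim, fun i => (IsEmpty.false i).elim⟩
  let T : Set ℝ := {t | ∃ x : ι → ℝ, (∀ i, 0 < x i) ∧ ∀ i, (Q *ᵥ x) i < t * x i}
  have hT1 : ∀ t ∈ T, 1 ≤ t := by
    rintro t ⟨x, hx, h⟩
    by_contra! ht
    exact hnot ⟨x, hx, fun i => (h i).trans (by nlinarith [hx i])⟩
  have hTne : T.Nonempty := by
    refine ⟨1 + ∑ i, ∑ j, Q i j, 1, fun _ => one_pos, fun i => ?_⟩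
    have : ∑ j, Q i j ≤ ∑ i, ∑ j, Q i j :=
      single_le_sum (f := fun i => ∑ j, Q i j) (fun i _ => sum_nonneg fun j _ => hQ i j)
        (mem_univ i)
    simp only [mulVec, dotProduct, Pi.one_apply, mul_one]
    linarith
  have hbdd : BddBelow T := ⟨1, hT1⟩
  set ρ := sInf T
  have hseq : ∀ n : ℕ, ∃ M ∈ stdSimplex ℝ (ι × ι), ∃ t ε : ℝ, ρ ≤ t ∧ t < ρ + 1 / ((n : ℝ) + 1) ∧
      0 ≤ ε ∧ ε ≤ t - ρ ∧
      Q * (Matrix.of fun i j => M (i, j)) =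
        t • (Matrix.of fun i j => M (i, j)) - ε • (1 : Matrix ι ι ℝ) ∧
      (Matrix.of fun i j => M (i, j)) * Q =
        t • (Matrix.of fun i j => M (i, j)) - ε • (1 : Matrix ι ι ℝ) := by
    intro n
    obtain ⟨t, htT, htlt⟩ := exists_lt_of_csInf_lt hTne
      (show ρ < ρ + 1 / ((n : ℝ) + 1) from lt_add_of_pos_right _ (by positivity))
    obtain ⟨x, hx, hxt⟩ := id htT
    let B : Matrix ι ι ℝ := t • (1 : Matrix ι ι ℝ) - Q
    have hB : ∀ i j, i ≠ j → B i j ≤ 0 := fun i j h => by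
      simp [B, Matrix.one_apply_ne h, hQ i j]
    have hBx : ∀ i, 0 < (B *ᵥ x) i := fun i => by
      simp only [B, sub_mulVec, smul_mulVec, one_mulVec, Pi.sub_apply, Pi.smul_apply, smul_eq_mul]
      linarith [hxt i]
    have hdet := isUnit_det_of_mulVec_pos hB hx hBx
    have hN := inv_nonneg_of_mulVec_pos hB hx hBx
    set N := B⁻¹
    have hBN : B * N = 1 := mul_nonsing_inv B hdet
    have hNB : N * B = 1 := nonsing_inv_mul B hdet
    have hQN : Q * N = t • N - 1 := by
      rw [← hBN]; simp [B, sub_mul]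
    have hNQ : N * Q = t • N - 1 := by
      rw [← hNB]; simp [B, mul_sub]
    -- Dividing by the total `s` puts `N` in the standard simplex, which is compact and excludes
    -- `0`. The error term in `Q * N = t • N - 1` becomes `ε = s⁻¹`.
    set s := ∑ p : ι × ι, N p.1 p.2 with hs
    have hs0 : 0 ≤ s := sum_nonneg fun p _ => hN _ _
    have hrow : ∀ i, (N *ᵥ 1) i ≤ s := by
      intro i
      rw [hs, Fintype.sum_prod_type]
      simp only [mulVec, dotProduct, Pi.one_apply, mul_one]
      exact single_le_sum (f := fun i => ∑ j, N i j) (fun i _ => sum_nonneg fun j _ => hN i j)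
        (mem_univ i)
    have hz0 : ∀ i, 0 ≤ (N *ᵥ 1) i := fun i => sum_nonneg fun j _ => mul_nonneg (hN i j) zero_le_one
    have hQz : ∀ i, (Q *ᵥ (N *ᵥ 1)) i = t * (N *ᵥ 1) i - 1 := by
      intro i
      rw [mulVec_mulVec, hQN, sub_mulVec, smul_mulVec, one_mulVec]; simp
    have ht0 : 1 ≤ t := hT1 t htT
    have hzpos : ∀ i, 0 < (N *ᵥ 1) i := by
      intro i
      have h1 : 0 ≤ (Q *ᵥ (N *ᵥ 1)) i := sum_nonneg fun j _ => mul_nonneg (hQ i j) (hz0 j)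
      rw [hQz] at h1
      nlinarith
    have hspos : 0 < s := (hzpos hne.some).trans_le (hrow _)
    -- The resolvent blows up near `ρ`: the vector `z = N 1` satisfies `Q z = t z - 1` and `z ≤ s`,
    -- so for `δ' < s⁻¹` it shows that `t - δ'` still lies in `T`.
    have hs1 : s⁻¹ ≤ t - ρ := by
      refine le_of_forall_lt fun δ hδ => ?_
      obtain ⟨δ', h1, h2⟩ := exists_between hδ
      have : t - δ' ∈ T := by
        refine ⟨N *ᵥ 1, hzpos, fun i => ?_⟩
        rw [hQz]
        have : δ' * (N *ᵥ 1) i < 1 := by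
          rcases le_or_gt δ' 0 with h | h
          · nlinarith [hzpos i]
          · calc δ' * (N *ᵥ 1) i ≤ δ' * s := by gcongr; exact hrow i
              _ < s⁻¹ * s := by gcongr
              _ = 1 := inv_mul_cancel₀ hspos.ne'
        linarith
      have := csInf_le hbdd this
      change ρ ≤ _ at this
      linarith
    have hof : (Matrix.of fun i j => (fun p : ι × ι => s⁻¹ * N p.1 p.2) (i, j)) = s⁻¹ • N := by
      ext; simp
    refine ⟨fun p => s⁻¹ * N p.1 p.2, ⟨fun p => mul_nonneg (inv_nonneg.2 hs0) (hN _ _), ?_⟩,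
      t, s⁻¹, csInf_le hbdd htT, htlt, inv_nonneg.2 hs0, hs1, ?_, ?_⟩
    · rw [← mul_sum, ← hs, inv_mul_cancel₀ hspos.ne']
    · rw [hof, Matrix.mul_smul, hQN, smul_sub, smul_comm]
    · rw [hof, Matrix.smul_mul, hNQ, smul_sub, smul_comm]
  choose M hM t ε h1 h2 h3 h4 h5 h6 using hseq
  obtain ⟨L, hL, φ, hφ, hlim⟩ := (isCompact_stdSimplex ℝ (ι × ι)).tendsto_subseq hM
  have htlim : Tendsto t atTop (𝓝 ρ) := by
    have h0 : Tendsto (fun n : ℕ => ρ + 1 / ((n : ℝ) + 1)) atTop (𝓝 ρ) := by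
      simpa using tendsto_const_nhds.add (tendsto_one_div_add_atTop_nhds_zero_nat (𝕜 := ℝ))
    exact tendsto_of_tendsto_of_tendsto_of_le_of_le tendsto_const_nhds h0 h1 fun n => (h2 n).le
  have hεlim : Tendsto ε atTop (𝓝 0) := by
    have h0 : Tendsto (fun n => t n - ρ) atTop (𝓝 0) := by
      simpa using htlim.sub_const ρ
    exact tendsto_of_tendsto_of_tendsto_of_le_of_le tendsto_const_nhds h0 h3 h4
  have hent : ∀ p, Tendsto (fun n => M (φ n) p) atTop (𝓝 (L p)) := tendsto_pi_nhds.1 hlim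
  have hMat : Tendsto (fun n => (Matrix.of fun i j => M (φ n) (i, j))) atTop
      (𝓝 (Matrix.of fun i j => L (i, j))) := by
    refine tendsto_pi_nhds.2 fun i => tendsto_pi_nhds.2 fun j => hent (i, j)
  have hrhs : Tendsto (fun n => t (φ n) • (Matrix.of fun i j => M (φ n) (i, j)) -
      ε (φ n) • (1 : Matrix ι ι ℝ)) atTop (𝓝 (ρ • (Matrix.of fun i j => L (i, j)))) := by
    have := ((htlim.comp hφ.tendsto_atTop).smul hMat).sub
      ((hεlim.comp hφ.tendsto_atTop).smul_const (1 : Matrix ι ι ℝ))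
    simpa using this
  refine ⟨ρ, le_csInf hTne hT1, Matrix.of fun i j => L (i, j), fun i j => hL.1 _, ?_, ?_, ?_⟩
  · intro h
    have h0 : ∀ p, L p = 0 := fun p => congrFun (congrFun h p.1) p.2
    have := hL.2
    simp [h0] at this
  · refine tendsto_nhds_unique ?_ hrhs
    simp only [← h5]
    exact ((continuous_const (y := Q)).matrix_mul continuous_id).continuousAt.tendsto.comp hMat
  · refine tendsto_nhds_unique ?_ hrhs
    simp only [← h6]
    exact ((continuous_id).matrix_mul (continuous_const (y := Q))).continuousAt.tendsto.comp hMat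

/-- Perron–Frobenius for an irreducible nonnegative matrix of spectral radius at least one. -/
theorem exists_pos_eigenvectors {Q : Matrix ι ι ℝ} (hQ : ∀ i j, 0 ≤ Q i j)
    (hirr : ∀ i j, Relation.ReflTransGen (fun a b => Q a b ≠ 0) i j)
    (hnot : ¬ ∃ x : ι → ℝ, (∀ i, 0 < x i) ∧ ∀ i, (Q *ᵥ x) i < x i) :
    ∃ ρ : ℝ, 1 ≤ ρ ∧ ∃ u v : ι → ℝ, (∀ i, 0 < u i) ∧ (∀ i, 0 < v i) ∧
      (∀ i, (Q *ᵥ u) i = ρ * u i) ∧ ∀ i, (Qᵀ *ᵥ v) i = ρ * v i := by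
  obtain ⟨ρ, hρ, N, hN, hN0, h1, h2⟩ := exists_nonneg_commuting_eigenmatrix hQ hnot
  -- Column `b` and row `a` through a nonzero entry of `N` serve as the right and left eigenvectors.
  obtain ⟨a, b, hab⟩ : ∃ a b, N a b ≠ 0 := by
    by_contra! h
    exact hN0 (by ext i j; exact h i j)
  have hu : ∀ i, (Q *ᵥ fun i => N i b) i = ρ * N i b := fun i => congrFun (congrFun h1 i) b
  have hv : ∀ i, (Qᵀ *ᵥ fun j => N a j) i = ρ * N a i := fun i => by
    have : (N * Q) a i = ρ * N a i := congrFun (congrFun h2 a) i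
    rw [← this]
    simp only [mulVec, dotProduct, Matrix.mul_apply, transpose_apply, mul_comm]
  refine ⟨ρ, hρ, fun i => N i b, fun j => N a j,
    pos_of_mulVec_eq_smul hQ hirr (fun i => hN i b) hab hu,
    pos_of_mulVec_eq_smul (fun i j => hQ j i) (fun i j => ?_) (fun j => hN a j) hab hv, hu, hv⟩
  exact Relation.reflTransGen_swap.1 (hirr j i)

end Perron

end GDDCriteria

namespace GDDCriteria

/-! ### The Friedland–Karlin inequality, irreducible blocks and gluing -/

section Coupling

open Matrix Finset

variable {ι : Type*} [Fintype ι] {Q : Matrix ι ι ℝ} {ρ : ℝ} {u v : ι → ℝ}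

/-- Row marginals of the pair weights `v i * Q i j * u j`; `sum_coupling_right` gives the column
marginals, which coincide with them. -/
theorem sum_coupling_left (hQu : ∀ i, (Q *ᵥ u) i = ρ * u i) (f : ι → ℝ) :
    ∑ i, ∑ j, v i * Q i j * u j * f i = ρ * ∑ i, v i * u i * f i := by
  rw [mul_sum]
  refine sum_congr rfl fun i _ => ?_
  calc ∑ j, v i * Q i j * u j * f i = v i * f i * (Q *ᵥ u) i := by
        simp only [mulVec, dotProduct, mul_sum]
        exact sum_congr rfl fun j _ => by ring
    _ = _ := by rw [hQu]; ring

theorem sum_coupling_right (hQv : ∀ i, (Qᵀ *ᵥ v) i = ρ * v i) (f : ι → ℝ) :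
    ∑ i, ∑ j, v i * Q i j * u j * f j = ρ * ∑ i, v i * u i * f i := by
  rw [sum_comm, mul_sum]
  refine sum_congr rfl fun i _ => ?_
  calc ∑ j, v j * Q j i * u i * f i = u i * f i * (Qᵀ *ᵥ v) i := by
        simp only [mulVec, dotProduct, mul_sum, transpose_apply]
        exact sum_congr rfl fun j _ => by ring
    _ = _ := by rw [hQv]; ring

/-- `Q u = ρ u > 0` rules out a zero row, so the logarithms taken below have positive arguments. -/
theorem sum_mul_div_pos (hQ : ∀ i j, 0 ≤ Q i j) (hρ : 1 ≤ ρ) (hu : ∀ i, 0 < u i)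
    (hQu : ∀ i, (Q *ᵥ u) i = ρ * u i) {x : ι → ℝ} (hx : ∀ i, 0 < x i) (i : ι) :
    0 < ∑ j, Q i j * (x j / x i) := by
  have hnn : ∀ j ∈ univ, 0 ≤ Q i j * (x j / x i) := fun j _ =>
    mul_nonneg (hQ i j) (div_pos (hx j) (hx i)).le
  refine (sum_nonneg hnn).lt_of_ne' fun h => ?_
  have h0 : (Q *ᵥ u) i = 0 := by
    refine sum_eq_zero fun j hj => ?_
    have := (sum_eq_zero_iff_of_nonneg hnn).1 h j hj
    exact mul_eq_zero_of_left ((mul_eq_zero.1 this).resolve_right (div_pos (hx j) (hx i)).ne') _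
  rw [hQu] at h0
  exact absurd h0 (mul_pos (by linarith) (hu i)).ne'

/-- The Friedland–Karlin inequality, for spectral radius at least one. -/
theorem sum_mul_log_nonneg (hQ : ∀ i j, 0 ≤ Q i j) (hρ : 1 ≤ ρ)
    (hu : ∀ i, 0 < u i) (hv : ∀ i, 0 < v i)
    (hQu : ∀ i, (Q *ᵥ u) i = ρ * u i) (hQv : ∀ i, (Qᵀ *ᵥ v) i = ρ * v i)
    {x : ι → ℝ} (hx : ∀ i, 0 < x i) :
    0 ≤ ∑ i, v i * u i * Real.log (∑ j, Q i j * (x j / x i)) := by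
  have hρ0 : 0 < ρ := by linarith
  set S : ι → ℝ := fun i => ∑ j, Q i j * (x j / x i) with hS
  have hSpos : ∀ i, 0 < S i := sum_mul_div_pos hQ hρ hu hQu hx
  set ξ : ι → ℝ := fun i => Real.log (x i / u i) with hξ
  have hxu : ∀ i, 0 < x i / u i := fun i => div_pos (hx i) (hu i)
  -- This is `log s ≤ s - 1` at `s = (x j / u j) / (x i / u i) * ρ / S i`, weighted by `v i * Q i j
  -- * u j`. The choice makes `s = 1` when `x = u`, and makes the right-hand side sum to zero over
  -- `j`.
  have key : ∀ i j, v i * Q i j * u j * (ξ j - ξ i + Real.log ρ - Real.log (S i)) ≤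
      v i * u i * ρ / S i * (Q i j * (x j / x i)) - v i * Q i j * u j := by
    intro i j
    have h1 := Real.log_le_sub_one_of_pos
      (show 0 < (x j / u j) / (x i / u i) * ρ / S i from
        div_pos (mul_pos (div_pos (hxu j) (hxu i)) hρ0) (hSpos i))
    rw [Real.log_div (mul_pos (div_pos (hxu j) (hxu i)) hρ0).ne' (hSpos i).ne',
      Real.log_mul (div_pos (hxu j) (hxu i)).ne' hρ0.ne',
      Real.log_div (hxu j).ne' (hxu i).ne'] at h1
    have h2 := mul_le_mul_of_nonneg_left h1
      (mul_nonneg (mul_nonneg (hv i).le (hQ i j)) (hu j).le)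
    refine h2.trans_eq ?_
    have := (hx i).ne'
    have := (hu i).ne'
    have := (hu j).ne'
    have := (hSpos i).ne'
    field_simp
  have hsum := sum_le_sum fun i (_ : i ∈ univ) => sum_le_sum fun j (_ : j ∈ univ) => key i j
  have hR : ∑ i, ∑ j, (v i * u i * ρ / S i * (Q i j * (x j / x i)) - v i * Q i j * u j) = 0 := by
    refine sum_eq_zero fun i _ => ?_
    rw [sum_sub_distrib, ← mul_sum]
    change v i * u i * ρ / S i * S i - _ = 0
    have : ∑ j, v i * Q i j * u j = v i * (Q *ᵥ u) i := by
      simp only [mulVec, dotProduct, mul_sum, mul_assoc]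
    rw [this, hQu, div_mul_cancel₀ _ (hSpos i).ne']
    ring
  -- The terms `ξ j` and `ξ i` cancel because the two marginals agree.
  have hL : ∑ i, ∑ j, v i * Q i j * u j * (ξ j - ξ i + Real.log ρ - Real.log (S i)) =
      ρ * ∑ i, v i * u i * Real.log ρ - ρ * ∑ i, v i * u i * Real.log (S i) := by
    simp only [mul_sub, mul_add, sum_sub_distrib, sum_add_distrib]
    rw [sum_coupling_left hQu, sum_coupling_right hQv, sum_coupling_left hQu (fun _ => Real.log ρ),
      sum_coupling_left hQu (fun i => Real.log (S i))]
    ring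
  rw [hL, hR] at hsum
  have hlog : 0 ≤ ∑ i, v i * u i * Real.log ρ :=
    sum_nonneg fun i _ => mul_nonneg (mul_pos (hv i) (hu i)).le (Real.log_nonneg hρ)
  have : ρ * ∑ i, v i * u i * Real.log ρ ≤ ρ * ∑ i, v i * u i * Real.log (S i) := by linarith
  exact hlog.trans (le_of_mul_le_mul_left this hρ0)

/-- Positive vectors that are dominated inside the levels of a block triangular matrix can be
rescaled to one that is dominated globally. -/
theorem exists_pos_dominated_of_levels {P : Matrix ι ι ℝ} (hP : ∀ i j, 0 ≤ P i j) (b : ι → ℕ)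
    (hb : ∀ i j, P i j ≠ 0 → b i ≤ b j) {d z : ι → ℝ} (hz : ∀ i, 0 < z i)
    (h : ∀ i, ∑ j with b j = b i, P i j * z j < d i * z i) :
    ∃ z : ι → ℝ, (∀ i, 0 < z i) ∧ ∀ i, ∑ j, P i j * z j < d i * z i := by
  have hev : ∀ᶠ ε in nhdsWithin (0 : ℝ) (Set.Ioi 0), ∀ i,
      ∑ j with b j = b i, P i j * z j + ε * ∑ j, P i j * z j < d i * z i := by
    rw [Filter.eventually_all]
    intro i
    have hc : Continuous fun ε : ℝ => ∑ j with b j = b i, P i j * z j + ε * ∑ j, P i j * z j := by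
      fun_prop
    have := (hc.continuousAt (x := 0)).eventually_lt (continuousAt_const (y := d i * z i)) (by simpa using h i)
    exact this.filter_mono nhdsWithin_le_nhds
  obtain ⟨ε, hε, hε0, hε1⟩ := (hev.and (Ioo_mem_nhdsGT (zero_lt_one (α := ℝ)))).exists
  -- An entry leading to a strictly higher level picks up at least one extra factor `ε`, so its
  -- contribution fits into the slack of the strict inequality inside the level.
  refine ⟨fun i => ε ^ b i * z i, fun i => mul_pos (pow_pos hε0 _) (hz i), fun i => ?_⟩
  have hterm : ∀ j, P i j * (ε ^ b j * z j) ≤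
      ε ^ b i * ((if b j = b i then P i j * z j else 0) + ε * (P i j * z j)) := by
    intro j
    have h0 := mul_nonneg (hP i j) (hz j).le
    have hεi := pow_nonneg hε0.le (b i)
    by_cases hij : P i j = 0
    · simp [hij]
    split_ifs with hbj
    · rw [hbj]
      nlinarith [mul_nonneg hεi (mul_nonneg hε0.le h0)]
    · have hlt : b i + 1 ≤ b j := lt_of_le_of_ne (hb i j hij) (Ne.symm hbj)
      have h1 : ε ^ b j ≤ ε ^ b i * ε := by
        rw [← pow_succ]; exact pow_le_pow_of_le_one hε0.le hε1.le hlt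
      nlinarith [mul_le_mul_of_nonneg_right h1 h0]
  calc ∑ j, P i j * (ε ^ b j * z j)
      ≤ ∑ j, ε ^ b i * ((if b j = b i then P i j * z j else 0) + ε * (P i j * z j)) :=
        sum_le_sum fun j _ => hterm j
    _ = ε ^ b i * (∑ j with b j = b i, P i j * z j + ε * ∑ j, P i j * z j) := by
        rw [← mul_sum, sum_add_distrib, ← mul_sum, sum_filter]
    _ < ε ^ b i * (d i * z i) := mul_lt_mul_of_pos_left (hε i) (pow_pos hε0 _)
    _ = d i * (ε ^ b i * z i) := by ring

variable [DecidableEq ι]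

/-- A Brauer–Ostrowski type criterion, with independent row and column weights, for the comparison
matrix `diagonal d - P` of an irreducible matrix. -/
theorem exists_pos_dominated_of_irreducible {P : Matrix ι ι ℝ} (hP : ∀ i j, 0 ≤ P i j)
    (hdiag : ∀ i, P i i = 0)
    (hirr : ∀ i j, Relation.ReflTransGen (fun a b => P a b ≠ 0) i j)
    {d x y : ι → ℝ} (hd : ∀ i, 0 < d i) (hx : ∀ i, 0 < x i) (hy : ∀ i, 0 < y i)
    {r c : ι → ℝ} (hr : ∀ i, r i = ∑ j, P i j * (x j / x i))
    (hc : ∀ i, c i = ∑ j, P j i * (y i / y j)) {p q p' q' : ℝ}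
    (hp : 0 ≤ p) (hq : 0 ≤ q) (hp' : 0 ≤ p') (hq' : 0 ≤ q')
    (h : ∀ i j, i ≠ j →
      r i ^ p * c i ^ q * (r j ^ p' * c j ^ q') < d i ^ (p + q) * d j ^ (p' + q')) :
    ∃ z : ι → ℝ, (∀ i, 0 < z i) ∧ ∀ i, ∑ j, P i j * z j < d i * z i := by
  by_contra hnot
  let Q : Matrix ι ι ℝ := Matrix.of fun i j => P i j / d i
  have hQ : ∀ i j, 0 ≤ Q i j := fun i j => div_nonneg (hP i j) (hd i).le
  have hPQ : ∀ i j, P i j = d i * Q i j := fun i j => by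
    simp only [Q, of_apply]; rw [mul_div_cancel₀ _ (hd i).ne']
  obtain ⟨ρ, hρ, u, v, hu, hv, hQu, hQv⟩ := exists_pos_eigenvectors hQ
    (fun i j => Relation.ReflTransGen.mono (fun a b hab => div_ne_zero hab (hd a).ne') i j (hirr i j)) (by
      rintro ⟨z, hz, hlt⟩
      refine hnot ⟨z, hz, fun i => ?_⟩
      have := mul_lt_mul_of_pos_left (hlt i) (hd i)
      simpa only [mulVec, dotProduct, mul_sum, ← mul_assoc, ← hPQ] using this)
  have hne : Nonempty ι := by
    by_contra h
    rw [not_nonempty_iff] at h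
    exact hnot ⟨0, fun i => (IsEmpty.false i).elim, fun i => (IsEmpty.false i).elim⟩
  -- The test vector `d / y` for the transpose of `Q` turns its weighted row sums into `c i / d i`:
  -- the factor `d` compensates for `Q` being normalised by rows.
  have hw : ∀ i, 0 < d i / y i := fun i => div_pos (hd i) (hy i)
  set R : ι → ℝ := fun i => ∑ j, Q i j * (x j / x i) with hRdef
  set C : ι → ℝ := fun i => ∑ j, Qᵀ i j * ((d j / y j) / (d i / y i)) with hCdef
  have hRpos : ∀ i, 0 < R i := sum_mul_div_pos hQ hρ hu hQu hx
  have hCpos : ∀ i, 0 < C i := sum_mul_div_pos (fun i j => hQ j i) hρ hv hQv hw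
  have hrR : ∀ i, r i = R i * d i := fun i => by
    rw [hr, hRdef, sum_mul]
    exact sum_congr rfl fun j _ => by rw [hPQ]; ring
  have hcC : ∀ i, c i = C i * d i := fun i => by
    rw [hc, hCdef, sum_mul]
    refine sum_congr rfl fun j _ => ?_
    rw [hPQ, transpose_apply]
    have := (hd i).ne'
    have := (hy i).ne'
    have := (hy j).ne'
    field_simp
  have hR : 0 ≤ ∑ i, v i * u i * Real.log (R i) := sum_mul_log_nonneg hQ hρ hu hv hQu hQv hx
  have hC : 0 ≤ ∑ i, v i * u i * Real.log (C i) := by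
    have := sum_mul_log_nonneg (fun i j => hQ j i) hρ hv hu hQv hQu hw
    simp only [mul_comm (u _) (v _)] at this
    exact this
  have hneg : ∀ i j, i ≠ j → p * Real.log (R i) + q * Real.log (C i) + p' * Real.log (R j) +
      q' * Real.log (C j) < 0 := by
    intro i j hij
    have h1 := h i j hij
    have hrp : ∀ i, 0 < r i := fun i => by rw [hrR]; exact mul_pos (hRpos i) (hd i)
    have hcp : ∀ i, 0 < c i := fun i => by rw [hcC]; exact mul_pos (hCpos i) (hd i)
    have e1 := Real.rpow_pos_of_pos (hrp i) p
    have e2 := Real.rpow_pos_of_pos (hcp i) q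
    have e3 := Real.rpow_pos_of_pos (hrp j) p'
    have e4 := Real.rpow_pos_of_pos (hcp j) q'
    have e5 := Real.rpow_pos_of_pos (hd i) (p + q)
    have e6 := Real.rpow_pos_of_pos (hd j) (p' + q')
    have h2 := Real.log_lt_log (by positivity) h1
    rw [Real.log_mul (by positivity) (by positivity), Real.log_mul e1.ne' e2.ne',
      Real.log_mul e3.ne' e4.ne', Real.log_mul e5.ne' e6.ne', Real.log_rpow (hrp i),
      Real.log_rpow (hcp i), Real.log_rpow (hrp j), Real.log_rpow (hcp j), Real.log_rpow (hd i),
      Real.log_rpow (hd j), hrR, hrR, hcC, hcC, Real.log_mul (hRpos i).ne' (hd i).ne',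
      Real.log_mul (hRpos j).ne' (hd j).ne', Real.log_mul (hCpos i).ne' (hd i).ne',
      Real.log_mul (hCpos j).ne' (hd j).ne'] at h2
    linarith
  -- One positive entry makes the averaged inequality strict; it is off the diagonal since `Q i i =
  -- 0`, so the pairwise hypothesis applies to it.
  obtain ⟨a, b, hab⟩ : ∃ a b, 0 < Q a b := by
    by_contra! h0
    obtain ⟨i⟩ := hne
    have h1 : (Q *ᵥ u) i ≤ 0 := sum_nonpos fun j _ => mul_nonpos_of_nonpos_of_nonneg (h0 i j) (hu j).le
    rw [hQu] at h1
    exact absurd h1 (mul_pos (by linarith) (hu i)).not_ge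
  have hQdiag : ∀ i, Q i i = 0 := fun i => by simp [Q, hdiag]
  have hterm : ∀ i j, v i * Q i j * u j * (p * Real.log (R i) + q * Real.log (C i) +
      p' * Real.log (R j) + q' * Real.log (C j)) ≤ 0 := by
    intro i j
    by_cases hij : i = j
    · subst hij; simp [hQdiag]
    · exact mul_nonpos_of_nonneg_of_nonpos
        (mul_nonneg (mul_nonneg (hv i).le (hQ i j)) (hu j).le) (hneg i j hij).le
  have hlt : ∑ i, ∑ j, v i * Q i j * u j * (p * Real.log (R i) + q * Real.log (C i) +
      p' * Real.log (R j) + q' * Real.log (C j)) < 0 := by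
    refine sum_neg' (fun i _ => sum_nonpos fun j _ => hterm i j) ⟨a, mem_univ a, ?_⟩
    refine sum_neg' (fun j _ => hterm a j) ⟨b, mem_univ b, ?_⟩
    have hne' : a ≠ b := fun e => by rw [e, hQdiag] at hab; exact lt_irrefl _ hab
    exact mul_neg_of_pos_of_neg (mul_pos (mul_pos (hv a) hab) (hu b)) (hneg a b hne')
  have heq : ∑ i, ∑ j, v i * Q i j * u j * (p * Real.log (R i) + q * Real.log (C i) +
      p' * Real.log (R j) + q' * Real.log (C j)) =
      ρ * ((p + p') * ∑ i, v i * u i * Real.log (R i) +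
        (q + q') * ∑ i, v i * u i * Real.log (C i)) := by
    have h1 : ∀ i j, v i * Q i j * u j * (p * Real.log (R i) + q * Real.log (C i) +
        p' * Real.log (R j) + q' * Real.log (C j)) =
        p * (v i * Q i j * u j * Real.log (R i)) + q * (v i * Q i j * u j * Real.log (C i)) +
        p' * (v i * Q i j * u j * Real.log (R j)) + q' * (v i * Q i j * u j * Real.log (C j)) :=
      fun i j => by ring
    simp only [h1, sum_add_distrib, ← mul_sum]
    rw [sum_coupling_left hQu, sum_coupling_left hQu (fun i => Real.log (C i)),
      sum_coupling_right hQv, sum_coupling_right hQv (fun i => Real.log (C i))]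
    ring
  rw [heq] at hlt
  exact absurd hlt (not_lt.2 (mul_nonneg (by linarith) (add_nonneg
    (mul_nonneg (add_nonneg hp hp') hR) (mul_nonneg (add_nonneg hq hq') hC))))

end Coupling

end GDDCriteria

namespace GDDCriteria

/-! ### Reduction of the criteria to products of powers -/

section Exponents

theorem geom_le_arith {a b t : ℝ} (ha : 0 ≤ a) (hb : 0 ≤ b) (ht : t ∈ Set.Icc (0 : ℝ) 1) :
    a ^ t * b ^ (1 - t) ≤ t * a + (1 - t) * b :=
  Real.geom_mean_le_arith_mean2_weighted ht.1 (sub_nonneg.2 ht.2) ha hb (by ring)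

theorem rpow_mul_rpow_rpow {a b : ℝ} (ha : 0 ≤ a) (hb : 0 ≤ b) (s t w : ℝ) :
    (a ^ s * b ^ t) ^ w = a ^ (w * s) * b ^ (w * t) := by
  rw [Real.mul_rpow (Real.rpow_nonneg ha s) (Real.rpow_nonneg hb t), ← Real.rpow_mul ha,
    ← Real.rpow_mul hb, mul_comm s, mul_comm t]

/-- Each of the twenty-two inequalities implies a purely multiplicative one. -/
theorem exists_exponents_of_criterion {n : ℕ} {d r c : Fin n → ℝ}
    (hr : ∀ i, 0 ≤ r i) (hc : ∀ i, 0 ≤ c i) {α β : ℝ}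
    (hα : α ∈ Set.Icc (0 : ℝ) 1) (hβ : β ∈ Set.Icc (0 : ℝ) 1) (k : Fin 22) :
    ∃ p q p' q' : ℝ, 0 ≤ p ∧ 0 ≤ q ∧ 0 ≤ p' ∧ 0 ≤ q' ∧ 0 < p + q + (p' + q') ∧
      ∀ i j, Criterion d r c α β i j k →
        r i ^ p * c i ^ q * (r j ^ p' * c j ^ q') < d i ^ (p + q) * d j ^ (p' + q') := by
  obtain ⟨hα0, hα1⟩ := id hα
  obtain ⟨hβ0, hβ1⟩ := id hβ
  have hα' : 0 ≤ 1 - α := sub_nonneg.2 hα1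
  have hβ' : 0 ≤ 1 - β := sub_nonneg.2 hβ1
  have e1 : α + (1 - α) = 1 := by ring
  have e2 : 1 - α + α = 1 := by ring
  have e3 : α * β + α * (1 - β) = α := by ring
  have e4 : (1 - α) * β + (1 - α) * (1 - β) = 1 - α := by ring
  have e5 : (1 - α) * (1 - β) + (1 - α) * β = 1 - α := by ring
  have hR : ∀ i (t : ℝ), 0 ≤ r i ^ t := fun i t => Real.rpow_nonneg (hr i) t
  have hC : ∀ i (t : ℝ), 0 ≤ c i ^ t := fun i t => Real.rpow_nonneg (hc i) t
  have arr : ∀ (i j : Fin n), ∀ t ∈ Set.Icc (0 : ℝ) 1,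
      r i ^ t * c i ^ (1 - t) * (r j ^ t * c j ^ (1 - t)) ≤
        (t * r i + (1 - t) * c i) * (t * r j + (1 - t) * c j) := fun i j t ht =>
    mul_le_mul (geom_le_arith (hr i) (hc i) ht) (geom_le_arith (hr j) (hc j) ht)
      (mul_nonneg (hR _ _) (hC _ _))
      (add_nonneg (mul_nonneg ht.1 (hr _)) (mul_nonneg (sub_nonneg.2 ht.2) (hc _)))
  have arc : ∀ (i j : Fin n), ∀ t ∈ Set.Icc (0 : ℝ) 1,
      r i ^ t * c i ^ (1 - t) * (c j ^ t * r j ^ (1 - t)) ≤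
        (t * r i + (1 - t) * c i) * (t * c j + (1 - t) * r j) := fun i j t ht =>
    mul_le_mul (geom_le_arith (hr i) (hc i) ht) (geom_le_arith (hc j) (hr j) ht)
      (mul_nonneg (hC _ _) (hR _ _))
      (add_nonneg (mul_nonneg ht.1 (hr _)) (mul_nonneg (sub_nonneg.2 ht.2) (hc _)))
  -- Criteria that differ only in using geometric or arithmetic means share their exponents: 3 and
  -- 4; 8, 10 and 12; 9, 11 and 13; 17, 19 and 21; 18, 20 and 22. The first four do not involve `j`,
  -- whence `p' = q' = 0`.
  fin_cases k
  · refine ⟨1, 0, 0, 0, by norm_num, le_rfl, le_rfl, le_rfl, by norm_num, fun i j h => ?_⟩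
    change r i < d i at h
    simpa using h
  · refine ⟨0, 1, 0, 0, le_rfl, by norm_num, le_rfl, le_rfl, by norm_num, fun i j h => ?_⟩
    change c i < d i at h
    simpa using h
  · refine ⟨α, 1 - α, 0, 0, hα0, hα', le_rfl, le_rfl, by norm_num, fun i j h => ?_⟩
    change r i ^ α * c i ^ (1 - α) < d i at h
    simpa using h
  · refine ⟨α, 1 - α, 0, 0, hα0, hα', le_rfl, le_rfl, by norm_num, fun i j h => ?_⟩
    change α * r i + (1 - α) * c i < d i at h
    simpa using (geom_le_arith (hr i) (hc i) hα).trans_lt h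
  · refine ⟨1, 0, 1, 0, by norm_num, le_rfl, by norm_num, le_rfl, by norm_num, fun i j h => ?_⟩
    change r i * r j < d i * d j at h
    simpa using h
  · refine ⟨0, 1, 0, 1, le_rfl, by norm_num, le_rfl, by norm_num, by norm_num, fun i j h => ?_⟩
    change c i * c j < d i * d j at h
    simpa using h
  · refine ⟨1, 0, 0, 1, by norm_num, le_rfl, le_rfl, by norm_num, by norm_num, fun i j h => ?_⟩
    change r i * c j < d i * d j at h
    simpa using h
  · refine ⟨α, 1 - α, α, 1 - α, hα0, hα', hα0, hα', by norm_num, fun i j h => ?_⟩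
    change (r i * r j) ^ α * (c i * c j) ^ (1 - α) < d i * d j at h
    rw [Real.mul_rpow (hr i) (hr j), Real.mul_rpow (hc i) (hc j)] at h
    rw [e1, Real.rpow_one, Real.rpow_one]
    linarith
  · refine ⟨α, 1 - α, 1 - α, α, hα0, hα', hα', hα0, by norm_num, fun i j h => ?_⟩
    change (r i * c j) ^ α * (r j * c i) ^ (1 - α) < d i * d j at h
    rw [Real.mul_rpow (hr i) (hc j), Real.mul_rpow (hr j) (hc i)] at h
    rw [e1, e2, Real.rpow_one, Real.rpow_one]
    linarith
  · refine ⟨α, 1 - α, α, 1 - α, hα0, hα', hα0, hα', by norm_num, fun i j h => ?_⟩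
    change α * (r i * r j) + (1 - α) * (c i * c j) < d i * d j at h
    replace h := (geom_le_arith (mul_nonneg (hr i) (hr j)) (mul_nonneg (hc i) (hc j)) hα).trans_lt h
    rw [Real.mul_rpow (hr i) (hr j), Real.mul_rpow (hc i) (hc j)] at h
    rw [e1, Real.rpow_one, Real.rpow_one]
    linarith
  · refine ⟨α, 1 - α, 1 - α, α, hα0, hα', hα', hα0, by norm_num, fun i j h => ?_⟩
    change α * (r i * c j) + (1 - α) * (r j * c i) < d i * d j at h
    replace h := (geom_le_arith (mul_nonneg (hr i) (hc j)) (mul_nonneg (hr j) (hc i)) hα).trans_lt h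
    rw [Real.mul_rpow (hr i) (hc j), Real.mul_rpow (hr j) (hc i)] at h
    rw [e1, e2, Real.rpow_one, Real.rpow_one]
    linarith
  · refine ⟨α, 1 - α, α, 1 - α, hα0, hα', hα0, hα', by norm_num, fun i j h => ?_⟩
    change (α * r i + (1 - α) * c i) * (α * r j + (1 - α) * c j) < d i * d j at h
    rw [e1, Real.rpow_one, Real.rpow_one]
    exact (arr i j α hα).trans_lt h
  · refine ⟨α, 1 - α, 1 - α, α, hα0, hα', hα', hα0, by norm_num, fun i j h => ?_⟩
    change (α * r i + (1 - α) * c i) * (α * c j + (1 - α) * r j) < d i * d j at h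
    rw [e1, e2, Real.rpow_one, Real.rpow_one, mul_comm (r j ^ _)]
    exact (arc i j α hα).trans_lt h
  · refine ⟨α, 0, 1 - α, 0, hα0, le_rfl, hα', le_rfl, by norm_num, fun i j h => ?_⟩
    change r i ^ α * r j ^ (1 - α) < d i ^ α * d j ^ (1 - α) at h
    simpa using h
  · refine ⟨0, α, 0, 1 - α, le_rfl, hα0, le_rfl, hα', by norm_num, fun i j h => ?_⟩
    change c i ^ α * c j ^ (1 - α) < d i ^ α * d j ^ (1 - α) at h
    simpa using h
  · refine ⟨α, 0, 0, 1 - α, hα0, le_rfl, le_rfl, hα', by norm_num, fun i j h => ?_⟩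
    change r i ^ α * c j ^ (1 - α) < d i ^ α * d j ^ (1 - α) at h
    simpa using h
  · refine ⟨α * β, α * (1 - β), (1 - α) * β, (1 - α) * (1 - β), by positivity, by positivity,
      by positivity, by positivity, by rw [e3, e4]; norm_num, fun i j h => ?_⟩
    change (r i ^ β * c i ^ (1 - β)) ^ α * (r j ^ β * c j ^ (1 - β)) ^ (1 - α) <
      d i ^ α * d j ^ (1 - α) at h
    rw [e3, e4]
    rwa [rpow_mul_rpow_rpow (hr i) (hc i), rpow_mul_rpow_rpow (hr j) (hc j)] at h
  · refine ⟨α * β, α * (1 - β), (1 - α) * (1 - β), (1 - α) * β, by positivity, by positivity,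
      by positivity, by positivity, by rw [e3, e5]; norm_num, fun i j h => ?_⟩
    change (r i ^ β * c i ^ (1 - β)) ^ α * (c j ^ β * r j ^ (1 - β)) ^ (1 - α) <
      d i ^ α * d j ^ (1 - α) at h
    rw [e3, e5, mul_comm (r j ^ _)]
    rwa [rpow_mul_rpow_rpow (hr i) (hc i), rpow_mul_rpow_rpow (hc j) (hr j)] at h
  · refine ⟨α * β, α * (1 - β), (1 - α) * β, (1 - α) * (1 - β), by positivity, by positivity,
      by positivity, by positivity, by rw [e3, e4]; norm_num, fun i j h => ?_⟩
    change β * (r i ^ α * r j ^ (1 - α)) + (1 - β) * (c i ^ α * c j ^ (1 - α)) <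
      d i ^ α * d j ^ (1 - α) at h
    replace h := (geom_le_arith (mul_nonneg (hR i _) (hR j _)) (mul_nonneg (hC i _) (hC j _))
      hβ).trans_lt h
    rw [rpow_mul_rpow_rpow (hr i) (hr j), rpow_mul_rpow_rpow (hc i) (hc j), mul_comm β α,
      mul_comm β (1 - α), mul_comm (1 - β) α, mul_comm (1 - β) (1 - α)] at h
    rw [e3, e4]
    linarith
  · refine ⟨α * β, α * (1 - β), (1 - α) * (1 - β), (1 - α) * β, by positivity, by positivity,
      by positivity, by positivity, by rw [e3, e5]; norm_num, fun i j h => ?_⟩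
    change β * (r i ^ α * c j ^ (1 - α)) + (1 - β) * (c i ^ α * r j ^ (1 - α)) <
      d i ^ α * d j ^ (1 - α) at h
    replace h := (geom_le_arith (mul_nonneg (hR i _) (hC j _)) (mul_nonneg (hC i _) (hR j _))
      hβ).trans_lt h
    rw [rpow_mul_rpow_rpow (hr i) (hc j), rpow_mul_rpow_rpow (hc i) (hr j), mul_comm β α,
      mul_comm β (1 - α), mul_comm (1 - β) α, mul_comm (1 - β) (1 - α)] at h
    rw [e3, e5]
    linarith
  · refine ⟨α * β, α * (1 - β), (1 - α) * β, (1 - α) * (1 - β), by positivity, by positivity,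
      by positivity, by positivity, by rw [e3, e4]; norm_num, fun i j h => ?_⟩
    change (β * r i + (1 - β) * c i) ^ α * (β * r j + (1 - β) * c j) ^ (1 - α) <
      d i ^ α * d j ^ (1 - α) at h
    rw [e3, e4, ← rpow_mul_rpow_rpow (hr i) (hc i), ← rpow_mul_rpow_rpow (hr j) (hc j)]
    refine lt_of_le_of_lt (mul_le_mul
      (Real.rpow_le_rpow (mul_nonneg (hR _ _) (hC _ _)) (geom_le_arith (hr i) (hc i) hβ) hα0)
      (Real.rpow_le_rpow (mul_nonneg (hR _ _) (hC _ _)) (geom_le_arith (hr j) (hc j) hβ) hα')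
      (Real.rpow_nonneg (mul_nonneg (hR _ _) (hC _ _)) _) (Real.rpow_nonneg ?_ _)) h
    exact add_nonneg (mul_nonneg hβ0 (hr _)) (mul_nonneg hβ' (hc _))
  · refine ⟨α * β, α * (1 - β), (1 - α) * (1 - β), (1 - α) * β, by positivity, by positivity,
      by positivity, by positivity, by rw [e3, e5]; norm_num, fun i j h => ?_⟩
    change (β * r i + (1 - β) * c i) ^ α * (β * c j + (1 - β) * r j) ^ (1 - α) <
      d i ^ α * d j ^ (1 - α) at h
    rw [e3, e5, mul_comm (r j ^ _), ← rpow_mul_rpow_rpow (hr i) (hc i),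
      ← rpow_mul_rpow_rpow (hc j) (hr j)]
    refine lt_of_le_of_lt (mul_le_mul
      (Real.rpow_le_rpow (mul_nonneg (hR _ _) (hC _ _)) (geom_le_arith (hr i) (hc i) hβ) hα0)
      (Real.rpow_le_rpow (mul_nonneg (hC _ _) (hR _ _)) (geom_le_arith (hc j) (hr j) hβ) hα')
      (Real.rpow_nonneg (mul_nonneg (hC _ _) (hR _ _)) _) (Real.rpow_nonneg ?_ _)) h
    exact add_nonneg (mul_nonneg hβ0 (hr _)) (mul_nonneg hβ' (hc _))

/-- At `α = β = 1` every right-hand side collapses to `r i`, `c i`, or a product of two such sums;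
the convention `0 ^ 0 = 1` covers vanishing sums. -/
theorem criterion_one_one {n : ℕ} {d r c : Fin n → ℝ} (hr : ∀ i, 0 ≤ r i) (hc : ∀ i, 0 ≤ c i)
    (hrd : ∀ i, r i < d i) (hcd : ∀ i, c i < d i) (i j : Fin n) (k : Fin 22) :
    Criterion d r c 1 1 i j k := by
  have h1 := mul_lt_mul'' (hrd i) (hrd j) (hr i) (hr j)
  have h2 := mul_lt_mul'' (hcd i) (hcd j) (hc i) (hc j)
  have h3 := mul_lt_mul'' (hrd i) (hcd j) (hr i) (hc j)
  have := hrd i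
  have := hcd i
  fin_cases k <;> simpa [Criterion]

/-- The left side is nonnegative, so the right side is positive. If `d i = 0`, using `i` in the
first slot forces `p + q = 0` and in the second slot `p' + q' = 0`, against `hsum`. A second index
is needed to form the pairs. -/
theorem pos_of_exponents {ι : Type*} [Nontrivial ι] {d r c : ι → ℝ} (hd : ∀ i, 0 ≤ d i)
    (hr : ∀ i, 0 ≤ r i) (hc : ∀ i, 0 ≤ c i) {p q p' q' : ℝ} (hsum : 0 < p + q + (p' + q'))
    (h : ∀ i j, i ≠ j →
      r i ^ p * c i ^ q * (r j ^ p' * c j ^ q') < d i ^ (p + q) * d j ^ (p' + q')) (i : ι) :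
    0 < d i := by
  refine (hd i).lt_of_ne' fun h0 => ?_
  obtain ⟨j, hj⟩ := exists_ne i
  have hpos : ∀ i j, i ≠ j → 0 < d i ^ (p + q) * d j ^ (p' + q') := fun i j hij =>
    lt_of_le_of_lt (mul_nonneg
      (mul_nonneg (Real.rpow_nonneg (hr i) _) (Real.rpow_nonneg (hc i) _))
      (mul_nonneg (Real.rpow_nonneg (hr j) _) (Real.rpow_nonneg (hc j) _))) (h i j hij)
  have h1 : p + q = 0 := by
    by_contra hne
    have := hpos i j hj.symm
    rw [h0, Real.zero_rpow hne, zero_mul] at this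
    exact lt_irrefl _ this
  have h2 : p' + q' = 0 := by
    by_contra hne
    have := hpos j i hj
    rw [h0, Real.zero_rpow hne, mul_zero] at this
    exact lt_irrefl _ this
  linarith

end Exponents

/-! ### From complex matrices and Frobenius forms to the nonnegative setting -/

section Matrices

open Finset

variable {n : ℕ}

/-- The moduli of the off-diagonal entries. -/
noncomputable def offDiagNorm (A : Matrix (Fin n) (Fin n) ℂ) : Matrix (Fin n) (Fin n) ℝ :=
  Matrix.of fun i j => if i = j then 0 else ‖A i j‖

theorem offDiagNorm_nonneg (A : Matrix (Fin n) (Fin n) ℂ) (i j : Fin n) :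
    0 ≤ offDiagNorm A i j := by
  simp only [offDiagNorm, Matrix.of_apply]; split_ifs <;> simp

theorem offDiagNorm_self (A : Matrix (Fin n) (Fin n) ℂ) (i : Fin n) : offDiagNorm A i i = 0 := by
  simp [offDiagNorm]

theorem offDiagNorm_of_ne (A : Matrix (Fin n) (Fin n) ℂ) {i j : Fin n} (h : i ≠ j) :
    offDiagNorm A i j = ‖A i j‖ := by
  simp [offDiagNorm, h]

theorem conj_diagonal_apply {x : Fin n → ℝ} (hx : ∀ i, 0 < x i) (A : Matrix (Fin n) (Fin n) ℂ)
    (i j : Fin n) :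
    ((Matrix.diagonal fun i => (x i : ℂ))⁻¹ * A * Matrix.diagonal fun i => (x i : ℂ)) i j =
      A i j * ((x j / x i : ℝ) : ℂ) := by
  have hinv : (Matrix.diagonal fun i => (x i : ℂ))⁻¹ = Matrix.diagonal fun i => ((x i)⁻¹ : ℂ) := by
    refine Matrix.inv_eq_left_inv ?_
    rw [Matrix.diagonal_mul_diagonal, ← Matrix.diagonal_one]
    congr 1
    ext i
    exact inv_mul_cancel₀ (by exact_mod_cast (hx i).ne')
  rw [hinv, Matrix.mul_diagonal, Matrix.diagonal_mul]
  push_cast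
  ring

theorem norm_conj_diagonal_apply {x : Fin n → ℝ} (hx : ∀ i, 0 < x i)
    (A : Matrix (Fin n) (Fin n) ℂ) (i j : Fin n) :
    ‖((Matrix.diagonal fun i => (x i : ℂ))⁻¹ * A * Matrix.diagonal fun i => (x i : ℂ)) i j‖ =
      ‖A i j‖ * (x j / x i) := by
  rw [conj_diagonal_apply hx, norm_mul, Complex.norm_real,
    Real.norm_of_nonneg (div_pos (hx j) (hx i)).le]

/-- Diagonal scaling preserves the zero pattern, so the conjugated matrix has the same diagonal
blocks as `A`. -/
theorem reach_conj_diagonal {x : Fin n → ℝ} (hx : ∀ i, 0 < x i) (A : Matrix (Fin n) (Fin n) ℂ) :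
    Reach ((Matrix.diagonal fun i => (x i : ℂ))⁻¹ * A * Matrix.diagonal fun i => (x i : ℂ)) =
      Reach A := by
  have : ∀ i j, ((Matrix.diagonal fun i => (x i : ℂ))⁻¹ * A *
      Matrix.diagonal fun i => (x i : ℂ)) i j ≠ 0 ↔ A i j ≠ 0 := fun i j => by
    rw [conj_diagonal_apply hx, mul_ne_zero_iff]
    exact and_iff_left (by exact_mod_cast (div_pos (hx j) (hx i)).ne')
  simp only [Reach, this]

theorem gdd_iff_exists_pos (A : Matrix (Fin n) (Fin n) ℂ) :
    GDD A ↔ ∃ x : Fin n → ℝ, (∀ i, 0 < x i) ∧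
      ∀ i, ∑ j, offDiagNorm A i j * x j < ‖A i i‖ * x i := by
  have key : ∀ x : Fin n → ℝ, (∀ i, 0 < x i) → ∀ i,
      (rowSum ((Matrix.diagonal fun i => (x i : ℂ))⁻¹ * A * Matrix.diagonal fun i => (x i : ℂ)) i <
        ‖((Matrix.diagonal fun i => (x i : ℂ))⁻¹ * A *
          Matrix.diagonal fun i => (x i : ℂ)) i i‖ ↔
      ∑ j, offDiagNorm A i j * x j < ‖A i i‖ * x i) := by
    intro x hx i
    simp only [rowSum, norm_conj_diagonal_apply hx, ← mul_div_assoc]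
    rw [← sum_div, div_lt_div_iff_of_pos_right (hx i),
      ← sum_erase univ (a := i) (f := fun j => offDiagNorm A i j * x j)
        (by simp [offDiagNorm_self])]
    rw [sum_congr rfl fun j hj =>
      congrArg (· * x j) (offDiagNorm_of_ne A (ne_of_mem_erase hj).symm).symm]
  constructor
  · rintro ⟨_, ⟨x, hx, rfl⟩, h⟩
    exact ⟨x, hx, fun i => (key x hx i).1 (h i)⟩
  · rintro ⟨x, hx, h⟩
    exact ⟨_, ⟨x, hx, rfl⟩, fun i => (key x hx i).2 (h i)⟩

/-- The position of the diagonal block of the `i`-th diagonal entry in a Frobenius form. -/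
def FrobeniusForm.level {A : Matrix (Fin n) (Fin n) ℂ} (F : FrobeniusForm A) (i : Fin n) : ℕ :=
  (F.e.symm i).1

theorem FrobeniusForm.level_eq_iff {A : Matrix (Fin n) (Fin n) ℂ} (F : FrobeniusForm A)
    (i j : Fin n) : F.level i = F.level j ↔ Reach A i j ∧ Reach A j i := by
  rw [← F.same_block_iff, Fin.ext_iff]; rfl

theorem FrobeniusForm.level_le {A : Matrix (Fin n) (Fin n) ℂ} (F : FrobeniusForm A)
    {i j : Fin n} (h : A i j ≠ 0) : F.level i ≤ F.level j := by
  by_contra! hlt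
  apply h
  have := F.triangular (i := F.e.symm i) (j := F.e.symm j) hlt
  simpa using this

theorem FrobeniusForm.level_le_of_reach {A : Matrix (Fin n) (Fin n) ℂ} (F : FrobeniusForm A)
    {i j : Fin n} (h : Reach A i j) : F.level i ≤ F.level j := by
  induction h with
  | refl => exact le_rfl
  | tail _ h ih => exact ih.trans (F.level_le h)

/-- Replaces the form chosen for the conjugated matrix by an arbitrary form of `A` itself, so that
`X` and `Y` can share one block structure. -/
theorem wRedRowSum_eq {A : Matrix (Fin n) (Fin n) ℂ} (F : FrobeniusForm A) {x : Fin n → ℝ}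
    (hx : ∀ i, 0 < x i) (i : Fin n) :
    wRedRowSum (Matrix.diagonal fun i => (x i : ℂ)) A i =
      ∑ j with F.level j = F.level i, offDiagNorm A i j * (x j / x i) := by
  classical
  rw [wRedRowSum, redRowSum, FrobeniusForm.rowSum_eq, reach_conj_diagonal hx]
  simp only [norm_conj_diagonal_apply hx]
  rw [sum_filter, sum_filter]
  refine sum_congr rfl fun j _ => ?_
  have h := F.level_eq_iff j i
  by_cases hij : j = i
  · subst hij; simp [offDiagNorm_self]
  · simp only [h, ne_eq, hij, not_false_eq_true, true_and, offDiagNorm_of_ne A (Ne.symm hij)]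
    exact if_congr and_comm rfl rfl

theorem wRedColSum_eq {A : Matrix (Fin n) (Fin n) ℂ} (F : FrobeniusForm A) {y : Fin n → ℝ}
    (hy : ∀ i, 0 < y i) (i : Fin n) :
    wRedColSum (Matrix.diagonal fun i => (y i : ℂ)) A i =
      ∑ j with F.level j = F.level i, offDiagNorm A j i * (y i / y j) := by
  classical
  rw [wRedColSum, redColSum, FrobeniusForm.colSum_eq, reach_conj_diagonal hy]
  simp only [norm_conj_diagonal_apply hy]
  rw [sum_filter, sum_filter]
  refine sum_congr rfl fun j _ => ?_
  have h := F.level_eq_iff j i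
  by_cases hij : j = i
  · subst hij; simp [offDiagNorm_self]
  · simp only [h, ne_eq, hij, not_false_eq_true, true_and, offDiagNorm_of_ne A hij]
    exact if_congr and_comm rfl rfl

theorem wRedRowSum_nonneg {A X : Matrix (Fin n) (Fin n) ℂ} (i : Fin n) : 0 ≤ wRedRowSum X A i := by
  unfold wRedRowSum redRowSum FrobeniusForm.rowSum GDDCriteria.rowSum
  exact sum_nonneg fun _ _ => norm_nonneg _

theorem wRedColSum_nonneg {A X : Matrix (Fin n) (Fin n) ℂ} (i : Fin n) : 0 ≤ wRedColSum X A i := by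
  unfold wRedColSum redColSum FrobeniusForm.colSum GDDCriteria.colSum
  exact sum_nonneg fun _ _ => norm_nonneg _

theorem GDD.exists_row_col {A : Matrix (Fin n) (Fin n) ℂ} (hA : GDD A) :
    ∃ X ∈ PosDiag n, ∃ Y ∈ PosDiag n,
      ∀ i, wRedRowSum X A i < ‖A i i‖ ∧ wRedColSum Y A i < ‖A i i‖ := by
  obtain ⟨x, hx, h⟩ := (gdd_iff_exists_pos A).1 hA
  obtain ⟨F⟩ := FrobeniusForm.exists A
  have hB : ∀ z i, ((Matrix.diagonal (fun i => ‖A i i‖) - offDiagNorm A).mulVec z) i =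
      ‖A i i‖ * z i - ∑ j, offDiagNorm A i j * z j := fun z i => by
    rw [Matrix.sub_mulVec, Pi.sub_apply, Matrix.mulVec_diagonal]; rfl
  obtain ⟨y, hy, hy'⟩ := exists_pos_transpose_mulVec_pos
    (B := Matrix.diagonal (fun i => ‖A i i‖) - offDiagNorm A)
    (fun i j hij => by simp [Matrix.diagonal_apply_ne _ hij, offDiagNorm_nonneg]) hx
    (fun i => by rw [hB]; linarith [h i])
  have hcol : ∀ i, ∑ j, offDiagNorm A j i * y j < ‖A i i‖ * y i := fun i => by
    have := hy' i
    rw [Matrix.transpose_sub, Matrix.diagonal_transpose, Matrix.sub_mulVec, Pi.sub_apply,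
      Matrix.mulVec_diagonal] at this
    simpa [Matrix.mulVec, dotProduct] using this
  have hyi : ∀ i, 0 < (y i)⁻¹ := fun i => inv_pos.2 (hy i)
  -- Conjugation by `Y` weights column `i` by `Y i / Y j`, so the left weights `y j / y i` require
  -- `Y = y⁻¹`.
  refine ⟨_, ⟨x, hx, rfl⟩, _, ⟨fun i => (y i)⁻¹, hyi, rfl⟩, fun i => ⟨?_, ?_⟩⟩
  · rw [wRedRowSum_eq F hx]
    refine (sum_le_sum_of_subset_of_nonneg (filter_subset _ _) fun j _ _ =>
      mul_nonneg (offDiagNorm_nonneg A _ _) (div_pos (hx _) (hx _)).le).trans_lt ?_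
    simp only [← mul_div_assoc]
    rw [← sum_div, div_lt_iff₀ (hx i)]
    exact h i
  · rw [wRedColSum_eq F hyi]
    refine (sum_le_sum_of_subset_of_nonneg (filter_subset _ _) fun j _ _ =>
      mul_nonneg (offDiagNorm_nonneg A _ _) (div_pos (hyi _) (hyi _)).le).trans_lt ?_
    have : ∀ j, offDiagNorm A j i * ((y i)⁻¹ / (y j)⁻¹) = offDiagNorm A j i * y j / y i :=
      fun j => by rw [inv_div_inv, mul_div_assoc]
    simp only [this]
    rw [← sum_div, div_lt_iff₀ (hy i)]
    exact hcol i

/-- Levels do not decrease along edges, so a path between two indices of equal level stays in that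
level. Loops are dropped because `offDiagNorm` vanishes on the diagonal. -/
theorem reach_subtype {A : Matrix (Fin n) (Fin n) ℂ} (F : FrobeniusForm A) {k : ℕ}
    (i j : {i // F.level i = k}) :
    Relation.ReflTransGen (fun a b : {i // F.level i = k} => offDiagNorm A a b ≠ 0) i j := by
  obtain ⟨i, hi⟩ := i
  obtain ⟨j, hj⟩ := j
  have h := ((F.level_eq_iff i j).1 (hi.trans hj.symm)).1
  induction h using Relation.ReflTransGen.head_induction_on with
  | refl => exact Relation.ReflTransGen.refl
  | @head a b hab hbj ih =>
    have hb : F.level b = k :=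
      le_antisymm (hj ▸ F.level_le_of_reach hbj) (hi ▸ F.level_le hab)
    by_cases hne : a = b
    · subst hne; exact ih hb
    · refine Relation.ReflTransGen.head ?_ (ih hb)
      simpa [offDiagNorm_of_ne A hne] using hab

theorem sum_level_eq_sum_subtype (b : Fin n → ℕ) (k : ℕ) (f : Fin n → ℝ) :
    ∑ j with b j = k, f j = ∑ j : {j // b j = k}, f j :=
  sum_subtype _ (by simp) f

theorem gdd_of_exponents {A : Matrix (Fin n) (Fin n) ℂ} {x y : Fin n → ℝ} (hx : ∀ i, 0 < x i)
    (hy : ∀ i, 0 < y i) (hd : ∀ i, 0 < ‖A i i‖) {p q p' q' : ℝ}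
    (hp : 0 ≤ p) (hq : 0 ≤ q) (hp' : 0 ≤ p') (hq' : 0 ≤ q') {r c : Fin n → ℝ}
    (hr : r = wRedRowSum (Matrix.diagonal fun i => (x i : ℂ)) A)
    (hc : c = wRedColSum (Matrix.diagonal fun i => (y i : ℂ)) A)
    (h : ∀ i j, i ≠ j → r i ^ p * c i ^ q * (r j ^ p' * c j ^ q') <
      ‖A i i‖ ^ (p + q) * ‖A j j‖ ^ (p' + q')) : GDD A := by
  obtain ⟨F⟩ := FrobeniusForm.exists A
  -- Here `k` ranges over all naturals; a level that does not occur gives an empty index type, where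
  -- the claim is vacuous.
  have hblock : ∀ k : ℕ, ∃ z : {i // F.level i = k} → ℝ, (∀ i, 0 < z i) ∧
      ∀ i : {i // F.level i = k}, ∑ j : {i // F.level i = k}, offDiagNorm A i j * z j <
        ‖A i i‖ * z i := by
    intro k
    refine exists_pos_dominated_of_irreducible
      (P := Matrix.of fun i j : {i // F.level i = k} => offDiagNorm A i j)
      (d := fun i => ‖A i i‖) (x := fun i => x i) (y := fun i => y i)
      (r := fun i => r i) (c := fun i => c i)
      (fun i j => offDiagNorm_nonneg A i j) (fun i => offDiagNorm_self A i)
      (reach_subtype F) (fun i => hd i) (fun i => hx i) (fun i => hy i) (fun i => ?_)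
      (fun i => ?_) hp hq hp' hq' (fun i j hij => h i j (Subtype.coe_ne_coe.2 hij))
    · rw [hr, wRedRowSum_eq F hx, i.2]
      exact sum_level_eq_sum_subtype _ _ _
    · rw [hc, wRedColSum_eq F hy, i.2]
      exact sum_level_eq_sum_subtype _ _ _
  choose z hz hlt using hblock
  rw [gdd_iff_exists_pos]
  refine exists_pos_dominated_of_levels (offDiagNorm_nonneg A) F.level (fun i j hij => ?_)
    (z := fun i => z (F.level i) ⟨i, rfl⟩) (fun i => hz _ _) (fun i => ?_)
  · refine F.level_le fun h0 => hij ?_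
    simp [offDiagNorm, h0]
  · rw [sum_level_eq_sum_subtype]
    convert hlt (F.level i) ⟨i, rfl⟩ using 1
    refine sum_congr rfl ?_
    rintro ⟨j, hj⟩ -
    -- The block vectors have index types depending on the level; generalising the level lets equal
    -- levels be identified.
    have : ∀ (k : ℕ) (hk : F.level j = k), z (F.level j) ⟨j, rfl⟩ = z k ⟨j, hk⟩ := by
      rintro _ rfl; rfl
    simp only [this _ hj]

theorem GDD.exists_satisfies {A : Matrix (Fin n) (Fin n) ℂ} (hA : GDD A) (k : Fin 22) :
    ∃ X ∈ PosDiag n, ∃ Y ∈ PosDiag n, ∃ α ∈ Set.Icc (0 : ℝ) 1, ∃ β ∈ Set.Icc (0 : ℝ) 1,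
      Satisfies A X Y α β k := by
  obtain ⟨X, hX, Y, hY, h⟩ := hA.exists_row_col
  exact ⟨X, hX, Y, hY, 1, by simp, 1, by simp, fun i j _ => criterion_one_one wRedRowSum_nonneg
    wRedColSum_nonneg (fun i => (h i).1) (fun i => (h i).2) i j k⟩

theorem Satisfies.gdd (hn : 2 ≤ n) {A X Y : Matrix (Fin n) (Fin n) ℂ} (hX : X ∈ PosDiag n)
    (hY : Y ∈ PosDiag n) {α β : ℝ} (hα : α ∈ Set.Icc (0 : ℝ) 1) (hβ : β ∈ Set.Icc (0 : ℝ) 1)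
    {k : Fin 22} (h : Satisfies A X Y α β k) : GDD A := by
  obtain ⟨x, hx, rfl⟩ := hX
  obtain ⟨y, hy, rfl⟩ := hY
  have : Nontrivial (Fin n) := Fin.nontrivial_iff_two_le.2 hn
  obtain ⟨p, q, p', q', hp, hq, hp', hq', hsum, hk⟩ := exists_exponents_of_criterion
    (d := fun t => ‖A t t‖) wRedRowSum_nonneg wRedColSum_nonneg hα hβ k
  have hlt := fun i j hij => hk i j (h i j hij)
  exact gdd_of_exponents hx hy (pos_of_exponents (fun _ => norm_nonneg _) wRedRowSum_nonneg
    wRedColSum_nonneg hsum hlt) hp hq hp' hq' rfl rfl hlt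

end Matrices

end GDDCriteria

theorem theorem4p2 (n : ℕ) (hn : 2 ≤ n) (A : Matrix (Fin n) (Fin n) ℂ) :
    (GDDCriteria.GDD A ↔
      ∃ X ∈ GDDCriteria.PosDiag n, ∃ Y ∈ GDDCriteria.PosDiag n,
        ∃ α ∈ Set.Icc (0 : ℝ) 1, ∃ β ∈ Set.Icc (0 : ℝ) 1,
          ∃ k : Fin 22, GDDCriteria.Satisfies A X Y α β k) ∧
    ∀ k : Fin 22,
      (GDDCriteria.GDD A ↔
        ∃ X ∈ GDDCriteria.PosDiag n, ∃ Y ∈ GDDCriteria.PosDiag n,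
          ∃ α ∈ Set.Icc (0 : ℝ) 1, ∃ β ∈ Set.Icc (0 : ℝ) 1,
            GDDCriteria.Satisfies A X Y α β k) := by
  refine ⟨⟨fun hA => ?_, ?_⟩, fun k => ⟨fun hA => hA.exists_satisfies k, ?_⟩⟩
  · obtain ⟨X, hX, Y, hY, α, hα, β, hβ, h⟩ := hA.exists_satisfies 0
    exact ⟨X, hX, Y, hY, α, hα, β, hβ, 0, h⟩
  · rintro ⟨X, hX, Y, hY, α, hα, β, hβ, k, h⟩
    exact h.gdd hn hX hY hα hβ
  · rintro ⟨X, hX, Y, hY, α, hα, β, hβ, h⟩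
    exact h.gdd hn hX hY hα hβ
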